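/- Let $T,D,a\in\mathbb{R}$ with $a^2+D^2\neq 0$ and consider the planar linear system in generalized Liénard form $\dot x=Tx-y$, $\dot y=Dx-a$. For $y_0\ge 0$ let $\Phi(t;y_0)=(\Phi_1(t;y_0),\Phi_2(t;y_0))$ be its solution with $\Phi(0;y_0)=(0,y_0)$. The left Poincaré half-map $P$ on the section $\{x=0\}$ and its interval of definition $I\subset[0,+\infty)$ are defined as follows. If there is $\tau>0$ such that $\Phi_1(\tau;y_0)=0$ and $\Phi_1(t;y_0)<0$ for every $t\in(0,\tau)$, then $y_0\in I$ and $P(y_0)=\Phi_2(\tau;y_0)$. If there is no such $\tau$ for $y_0=0$, but for every $\varepsilon>0$ there exist $y_0'\in(0,\varepsilon)\cap I$ with $P(y_0')\in(-\varepsilon,0)$, then $0\in I$ and $P(0)=0$. No other point belongs to $I$. Then \[ \operatorname{sign}\left(y_0+P(y_0)\right)=-\operatorname{sign}(T)\qquad\text{for every } y_0\in I\setminus\{0\}. \] In addition, if $0\in I$, and $P(0)\neq 0$ or $T=0$, the relationship also holds for $y_0=0$. Consequently, for every $y_0\in I$ such that $y_0\ne 0$, or $P(y_0)\neq 0$, or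 $T=0$, one has $P(y_0)=-y_0$ if and only if $T=0$. -/

import Mathlib

/-- `φ = (x, y)` is a (global) solution of the planar linear system in generalized Liénard form
`x' = T x - y`, `y' = D x - a`. -/
def IsLienardSolution (T D a : ℝ) (φ : ℝ → ℝ × ℝ) : Prop :=
  ∀ t : ℝ, HasDerivAt φ (T * (φ t).1 - (φ t).2, D * (φ t).1 - a) t

/-- The solution `Φ(·; y₀)` starting at `(0, y₀)`, with `y₀ ≥ 0`, enters the open left half-plane
immediately, stays in it for `0 < t < τ`, and meets the section `x = 0` again at the (left flight)
time `τ > 0`, at the point `(0, y₁)`. -/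
def LeftReturn (T D a y₀ y₁ : ℝ) : Prop :=
  0 ≤ y₀ ∧ ∃ Φ : ℝ → ℝ × ℝ, IsLienardSolution T D a Φ ∧ Φ 0 = (0, y₀) ∧
    ∃ τ : ℝ, 0 < τ ∧ (Φ τ).1 = 0 ∧ (∀ t ∈ Set.Ioo 0 τ, (Φ t).1 < 0) ∧ (Φ τ).2 = y₁

/-- `y₁` is the image of `y₀` under the left Poincaré half-map: either `y₁` is the point of first
return through the left half-plane, or `y₀ = y₁ = 0`, the orbit of the origin has no such return,
and the half-map is extended continuously by the value `0`, which is done when there are points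
`y₀' > 0` and `y₁' < 0` arbitrarily close to `0` such that `y₁'` is the image of `y₀'`. -/
def IsLeftImage (T D a y₀ y₁ : ℝ) : Prop :=
  LeftReturn T D a y₀ y₁ ∨
    (y₀ = 0 ∧ y₁ = 0 ∧ (¬ ∃ z : ℝ, LeftReturn T D a 0 z) ∧
      ∀ ε : ℝ, 0 < ε → ∃ y₀' ∈ Set.Ioo 0 ε, ∃ y₁' ∈ Set.Ioo (-ε) 0, LeftReturn T D a y₀' y₁')

/-- The interval of definition `I` of the left Poincaré half-map. -/
def leftDomain (T D a : ℝ) : Set ℝ := {y₀ | ∃ y₁ : ℝ, IsLeftImage T D a y₀ y₁}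

/-- The left Poincaré half-map `P`; it is meaningful on `leftDomain T D a` only. -/
noncomputable def leftHalfMap (T D a y₀ : ℝ) : ℝ :=
  Classical.epsilon fun y₁ : ℝ => IsLeftImage T D a y₀ y₁

/-- Solutions are determined by their initial value. -/
theorem IsLienardSolution.unique {T D a : ℝ} {φ ψ : ℝ → ℝ × ℝ} (hφ : IsLienardSolution T D a φ)
    (hψ : IsLienardSolution T D a ψ) (h : φ 0 = ψ 0) : φ = ψ := by
  let L : ℝ × ℝ →L[ℝ] ℝ × ℝ :=
    (T • ContinuousLinearMap.fst ℝ ℝ ℝ - ContinuousLinearMap.snd ℝ ℝ ℝ).prod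
      (D • ContinuousLinearMap.fst ℝ ℝ ℝ)
  have hv : ∀ t : ℝ, LipschitzOnWith ‖L‖₊
      (fun p : ℝ × ℝ => (T * p.1 - p.2, D * p.1 - a)) Set.univ := by
    intro t
    refine LipschitzOnWith.of_dist_le_mul fun p _ q _ => ?_
    have e : ((T * p.1 - p.2, D * p.1 - a) : ℝ × ℝ) - (T * q.1 - q.2, D * q.1 - a) = L (p - q) := by
      ext
      · simp [L]; ring
      · simp [L]; ring
    rw [dist_eq_norm, dist_eq_norm, e]
    exact L.le_opNorm _
  exact ODE_solution_unique_univ (v := fun _ p => (T * p.1 - p.2, D * p.1 - a))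
    (s := fun _ => Set.univ) (t₀ := 0) hv (fun t => ⟨hφ t, trivial⟩) (fun t => ⟨hψ t, trivial⟩) h

/-- The point of first return is unique. -/
theorem LeftReturn.unique {T D a y₀ y₁ z₁ : ℝ} (h : LeftReturn T D a y₀ y₁)
    (h' : LeftReturn T D a y₀ z₁) : y₁ = z₁ := by
  obtain ⟨_, Φ, hΦ, h0, τ, hτ, hx, hneg, rfl⟩ := h
  obtain ⟨_, Ψ, hΨ, k0, σ, hσ, kx, kneg, rfl⟩ := h'
  obtain rfl := hΦ.unique hΨ (h0.trans k0.symm)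
  rcases lt_trichotomy τ σ with hlt | rfl | hlt
  · exact absurd hx (kneg τ ⟨hτ, hlt⟩).ne
  · rfl
  · exact absurd kx (hneg σ ⟨hσ, hlt⟩).ne

/-- The left Poincaré half-map is single-valued. -/
theorem IsLeftImage.unique {T D a y₀ y₁ z₁ : ℝ} (h : IsLeftImage T D a y₀ y₁)
    (h' : IsLeftImage T D a y₀ z₁) : y₁ = z₁ := by
  rcases h with h | ⟨rfl, rfl, hn, _⟩ <;> rcases h' with h' | ⟨e, rfl, hn', _⟩
  · exact h.unique h'
  · subst e
    exact absurd ⟨_, h⟩ hn'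
  · exact absurd ⟨_, h'⟩ hn
  · rfl

/-- On its interval of definition, `leftHalfMap` takes the value defined by `IsLeftImage`. -/
theorem leftHalfMap_spec {T D a y₀ : ℝ} (h : y₀ ∈ leftDomain T D a) :
    IsLeftImage T D a y₀ (leftHalfMap T D a y₀) :=
  Classical.epsilon_spec h

/-!
The proof is a sign computation for the area enclosed by an orbit arc and the section `x = 0`.

Along a solution, `y² + D x² - 2 a x` has derivative `2 T x (D x - a)`. Over a left return from
`(0, y₀)` to `(0, y₁)` this integrates to `y₁² - y₀² = 2 T A`, where `A = ∫ x y' dt` is the area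
enclosed by the arc and the section (Green's formula). If `A > 0`, then `y₁² - y₀²` has the sign
of `T`, and `y₁ ≤ 0 ≤ y₀` turns this into the sign of `y₀ + y₁`.

The positivity of `A` is proved without using the geometry of the arc. Either the integrand
`x (D x - a)` is positive, or, for a focus in `x ≤ 0` (`T² < 4 D` and `a ≤ 0`), one passes to the
symmetric area form centred at the equilibrium, `(u v' - v u') / 2` with `u = x - a / D` and
`v = y - T a / D`, which is a positive definite quadratic form in `(u, v)`; the segment of the
section then contributes `a (y₁ - y₀) / (2 D) ≥ 0`. When the eigenvalues are
real, factoring the second-order operator into two first-order ones shows that a return forces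
`a > 0` (`LeftReturn.pos_of_real_eigenvalues`) and that `y' = D x - a` stays negative
(`IsLienardSolution.snd_deriv_neg`). The mean value theorem replaces all integrals, so that the
area appears only as some positive number (`LeftReturn.exists_area`).
-/

/-! ### A first-order comparison -/

/-- If `f' ≤ l f` on `[s, t]`, then `f · exp (-l ·)` does not increase from `s` to `t`. -/
theorem mul_exp_neg_le_of_deriv_le {f g : ℝ → ℝ} {l s t : ℝ} (hst : s ≤ t)
    (hf : ∀ r, HasDerivAt f (l * f r + g r) r) (hg : ∀ r ∈ Set.Icc s t, g r ≤ 0) :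
    f t * Real.exp (-l * t) ≤ f s * Real.exp (-l * s) := by
  have hd : ∀ r, HasDerivAt (fun r => f r * Real.exp (-l * r)) (g r * Real.exp (-l * r)) r := by
    intro r
    have he : HasDerivAt (fun r : ℝ => Real.exp (-l * r)) (Real.exp (-l * r) * (-l * 1)) r :=
      ((hasDerivAt_id r).const_mul (-l)).exp
    exact ((hf r).mul he).congr_deriv (by ring)
  have hanti : AntitoneOn (fun r => f r * Real.exp (-l * r)) (Set.Icc s t) := by
    refine antitoneOn_of_deriv_nonpos (convex_Icc s t)
      (fun r _ => (hd r).continuousAt.continuousWithinAt)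
      (fun r _ => (hd r).differentiableAt.differentiableWithinAt) fun r hr => ?_
    rw [(hd r).deriv]
    exact mul_nonpos_of_nonpos_of_nonneg (hg r (interior_subset hr)) (Real.exp_pos _).le
  exact hanti (Set.left_mem_Icc.2 hst) (Set.right_mem_Icc.2 hst) hst

theorem nonpos_of_deriv_le {f g : ℝ → ℝ} {l s t : ℝ} (hst : s ≤ t)
    (hf : ∀ r, HasDerivAt f (l * f r + g r) r) (hg : ∀ r ∈ Set.Icc s t, g r ≤ 0)
    (hs : f s ≤ 0) : f t ≤ 0 := by
  have h := mul_exp_neg_le_of_deriv_le hst hf hg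
  have h' := mul_nonpos_of_nonpos_of_nonneg hs (Real.exp_pos (-l * s)).le
  exact nonpos_of_mul_nonpos_left (h.trans h') (Real.exp_pos _)

theorem neg_of_deriv_le {f g : ℝ → ℝ} {l s t : ℝ} (hst : s ≤ t)
    (hf : ∀ r, HasDerivAt f (l * f r + g r) r) (hg : ∀ r ∈ Set.Icc s t, g r ≤ 0)
    (hs : f s < 0) : f t < 0 := by
  have h := mul_exp_neg_le_of_deriv_le hst hf hg
  have h' := mul_neg_of_neg_of_pos hs (Real.exp_pos (-l * s))
  exact neg_of_mul_neg_left (h.trans_lt h') (Real.exp_pos _).le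

/-! ### Solutions of the Liénard system -/

namespace IsLienardSolution

variable {T D a : ℝ} {Φ : ℝ → ℝ × ℝ}

theorem hasDerivAt_fst (h : IsLienardSolution T D a Φ) (t : ℝ) :
    HasDerivAt (fun t => (Φ t).1) (T * (Φ t).1 - (Φ t).2) t :=
  (ContinuousLinearMap.fst ℝ ℝ ℝ).hasFDerivAt.comp_hasDerivAt t (h t)

theorem hasDerivAt_snd (h : IsLienardSolution T D a Φ) (t : ℝ) :
    HasDerivAt (fun t => (Φ t).2) (D * (Φ t).1 - a) t :=
  (ContinuousLinearMap.snd ℝ ℝ ℝ).hasFDerivAt.comp_hasDerivAt t (h t)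

/-- A solution passing through an equilibrium is constant. -/
theorem eq_of_equilibrium (h : IsLienardSolution T D a Φ) {c : ℝ}
    (h₁ : T * (Φ c).1 - (Φ c).2 = 0) (h₂ : D * (Φ c).1 - a = 0) (t : ℝ) : Φ t = Φ c := by
  have hshift : IsLienardSolution T D a fun t => Φ (t + c) := fun t =>
    (h (t + c)).comp_add_const t c
  have hconst : IsLienardSolution T D a fun _ => Φ c := fun t =>
    (hasDerivAt_const t (Φ c)).congr_deriv (Prod.ext h₁.symm h₂.symm)
  have := congrFun (hshift.unique hconst (by simp)) (t - c)
  simpa using this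

/-- With real eigenvalues, a solution starting on `x = 0`, `y ≥ 0` cannot be in `x < 0` and return
to `x = 0` later if `a ≤ 0`. Here `l` and `m` are the eigenvalues: `m x - y = x' - l x` satisfies
`w' = m w + a`, so it stays nonpositive, and hence `x · exp (-l ·)` is nonincreasing. -/
theorem fst_neg_of_real_eigenvalues {l m : ℝ} (h : IsLienardSolution T D a Φ) (hT : l + m = T)
    (hD : l * m = D) (ha : a ≤ 0) (hx : (Φ 0).1 = 0) (hy : 0 ≤ (Φ 0).2) {s t : ℝ} (hs : 0 ≤ s)
    (hst : s ≤ t) (hneg : (Φ s).1 < 0) : (Φ t).1 < 0 := by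
  have hw : ∀ r, HasDerivAt (fun r => m * (Φ r).1 - (Φ r).2)
      (m * (m * (Φ r).1 - (Φ r).2) + a) r := fun r => by
    refine (((h.hasDerivAt_fst r).const_mul m).sub (h.hasDerivAt_snd r)).congr_deriv ?_
    subst hT hD
    ring
  have hw_nonpos : ∀ r, 0 ≤ r → m * (Φ r).1 - (Φ r).2 ≤ 0 := fun r hr =>
    nonpos_of_deriv_le (f := fun r => m * (Φ r).1 - (Φ r).2) (g := fun _ => a) hr hw
      (fun _ _ => ha) (by simpa [hx] using hy)
  refine neg_of_deriv_le (f := fun r => (Φ r).1) (g := fun r => m * (Φ r).1 - (Φ r).2) (l := l)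
    hst (fun r => ?_) (fun r hr => hw_nonpos r (hs.trans hr.1)) hneg
  refine (h.hasDerivAt_fst r).congr_deriv ?_
  subst hT
  ring

/-- With real eigenvalues `l`, `m`, the function `z = y' = D x - a` stays negative between two
times at which it is negative: `w = z' - l z` satisfies `w' = m w`, so it has constant sign, and
`z · exp (-l ·)` is monotone. -/
theorem snd_deriv_neg {l m : ℝ} (h : IsLienardSolution T D a Φ) (hT : l + m = T) (hD : l * m = D)
    {t τ : ℝ} (ht : t ∈ Set.Icc 0 τ) (h0 : D * (Φ 0).1 - a < 0) (hτ : D * (Φ τ).1 - a < 0) :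
    D * (Φ t).1 - a < 0 := by
  have hw : ∀ r, HasDerivAt (fun r => D * (m * (Φ r).1 - (Φ r).2) + l * a)
      (m * (D * (m * (Φ r).1 - (Φ r).2) + l * a) + 0) r := fun r => by
    refine (((((h.hasDerivAt_fst r).const_mul m).sub (h.hasDerivAt_snd r)).const_mul D).add_const
      (l * a)).congr_deriv ?_
    subst hT hD
    ring
  have hz : ∀ r, HasDerivAt (fun r => D * (Φ r).1 - a)
      (l * (D * (Φ r).1 - a) + (D * (m * (Φ r).1 - (Φ r).2) + l * a)) r := fun r => by
    refine (((h.hasDerivAt_fst r).const_mul D).sub_const a).congr_deriv ?_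
    subst hT
    ring
  rcases le_total (D * (m * (Φ 0).1 - (Φ 0).2) + l * a) 0 with h₀ | h₀
  · exact neg_of_deriv_le (f := fun r => D * (Φ r).1 - a) ht.1 hz
      (fun r hr => nonpos_of_deriv_le
        (f := fun r => D * (m * (Φ r).1 - (Φ r).2) + l * a) hr.1 hw (by simp) h₀) h0
  · -- Here `z · exp (-l ·)` is nondecreasing, and the sign at `τ` is carried back to `t`.
    have hw_neg : ∀ r, 0 ≤ r → -(D * (m * (Φ r).1 - (Φ r).2) + l * a) ≤ 0 := fun r hr =>
      nonpos_of_deriv_le (f := fun r => -(D * (m * (Φ r).1 - (Φ r).2) + l * a))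
        (g := fun _ => 0) hr (fun r => (hw r).neg.congr_deriv (by ring)) (by simp) (by linarith)
    have hle := mul_exp_neg_le_of_deriv_le (f := fun r => -(D * (Φ r).1 - a)) ht.2
      (fun r => (hz r).neg.congr_deriv (by ring)) (fun r hr => hw_neg r (ht.1.trans hr.1))
    have hpos := mul_pos (neg_pos.2 hτ) (Real.exp_pos (-l * τ))
    exact neg_pos.1 (pos_of_mul_pos_left (hpos.trans_le hle) (Real.exp_pos _).le)

/-- Mean value form of `y₁² - y₀² = 2 T ∫ x (D x - a) dt`. -/
theorem exists_sq_sub_sq (h : IsLienardSolution T D a Φ) {τ : ℝ} (hτ : 0 < τ)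
    (hx₀ : (Φ 0).1 = 0) (hx : (Φ τ).1 = 0) :
    ∃ c ∈ Set.Ioo 0 τ,
      (Φ τ).2 ^ 2 - (Φ 0).2 ^ 2 = T * (2 * ((Φ c).1 * (D * (Φ c).1 - a)) * τ) := by
  have hd : ∀ t, HasDerivAt (fun t => (Φ t).2 ^ 2 + D * (Φ t).1 ^ 2 - 2 * a * (Φ t).1)
      (T * (2 * ((Φ t).1 * (D * (Φ t).1 - a)))) t := fun t => by
    refine ((((h.hasDerivAt_snd t).pow 2).add (((h.hasDerivAt_fst t).pow 2).const_mul D)).sub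
      ((h.hasDerivAt_fst t).const_mul (2 * a))).congr_deriv ?_
    ring
  obtain ⟨c, hc, hmv⟩ := exists_hasDerivAt_eq_slope _ _ hτ
    (fun t _ => (hd t).continuousAt.continuousWithinAt) fun t _ => hd t
  refine ⟨c, hc, ?_⟩
  rw [eq_div_iff (by linarith), hx, hx₀] at hmv
  linear_combination -hmv

/-- The analogue of `exists_sq_sub_sq` for the symmetric area form centred at the equilibrium, with
`D x - a` and `D y - T a` for `D` times the centred coordinates, so that no division occurs. -/
theorem exists_sq_sub_sq_centred (h : IsLienardSolution T D a Φ) {τ : ℝ} (hτ : 0 < τ)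
    (hx₀ : (Φ 0).1 = 0) (hx : (Φ τ).1 = 0) :
    ∃ c ∈ Set.Ioo 0 τ, D ^ 2 * ((Φ τ).2 ^ 2 - (Φ 0).2 ^ 2) =
      T * ((D * (D * (Φ c).1 - a) ^ 2 - T * (D * (Φ c).1 - a) * (D * (Φ c).2 - T * a)
        + (D * (Φ c).2 - T * a) ^ 2) * τ + a * D * ((Φ τ).2 - (Φ 0).2)) := by
  have hd : ∀ t, HasDerivAt
      (fun t => D ^ 2 * (Φ t).2 ^ 2 + D ^ 3 * (Φ t).1 ^ 2 - 2 * D ^ 2 * a * (Φ t).1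
        - T * ((D * (Φ t).1 + a) * (D * (Φ t).2 - T * a)))
      (T * (D * (D * (Φ t).1 - a) ^ 2 - T * (D * (Φ t).1 - a) * (D * (Φ t).2 - T * a)
        + (D * (Φ t).2 - T * a) ^ 2)) t := fun t => by
    have hx' := h.hasDerivAt_fst t
    have hy' := h.hasDerivAt_snd t
    refine (((((hy'.pow 2).const_mul (D ^ 2)).add ((hx'.pow 2).const_mul (D ^ 3))).sub
      (hx'.const_mul (2 * D ^ 2 * a))).sub ((((hx'.const_mul D).add_const a).mul
        ((hy'.const_mul D).sub_const (T * a))).const_mul T)).congr_deriv ?_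
    ring
  obtain ⟨c, hc, hmv⟩ := exists_hasDerivAt_eq_slope _ _ hτ
    (fun t _ => (hd t).continuousAt.continuousWithinAt) fun t _ => hd t
  refine ⟨c, hc, ?_⟩
  rw [eq_div_iff (by linarith), hx, hx₀] at hmv
  linear_combination -hmv

end IsLienardSolution

/-! ### The left return -/

namespace LeftReturn

variable {T D a y₀ y₁ : ℝ}

theorem image_nonpos (h : LeftReturn T D a y₀ y₁) : y₁ ≤ 0 := by
  obtain ⟨-, Φ, hΦ, -, τ, hτ, hx, hneg, rfl⟩ := h
  have hd := hΦ.hasDerivAt_fst τ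
  rw [hx, mul_zero, zero_sub] at hd
  have hslope := (hasDerivWithinAt_iff_tendsto_slope' (by simp)).1
    (hd.hasDerivWithinAt (s := Set.Iio τ))
  refine neg_nonneg.1 (ge_of_tendsto hslope ?_)
  filter_upwards [Ioo_mem_nhdsLT hτ] with t ht
  rw [slope_def_field, hx, sub_zero]
  exact div_nonneg_of_nonpos (hneg t ht).le (sub_nonpos.2 ht.2.le)

theorem pos_of_real_eigenvalues {l m : ℝ} (h : LeftReturn T D a y₀ y₁) (hT : l + m = T)
    (hD : l * m = D) : 0 < a := by
  obtain ⟨hy₀, Φ, hΦ, h0, τ, hτ, hx, hneg, -⟩ := h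
  by_contra! ha
  have := hΦ.fst_neg_of_real_eigenvalues hT hD ha (by simp [h0]) (by simpa [h0] using hy₀)
    (half_pos hτ).le (half_le_self hτ.le) (hneg _ ⟨half_pos hτ, half_lt_self hτ⟩)
  exact this.ne hx

/-- The number `A` is twice the area enclosed by the orbit arc and the section; only its sign
matters. -/
theorem exists_area (h : LeftReturn T D a y₀ y₁) : ∃ A > 0, y₁ ^ 2 - y₀ ^ 2 = T * A := by
  have hy₁ := h.image_nonpos
  have hreal : ∀ {l m : ℝ}, l + m = T → l * m = D → 0 < a := fun hT hD =>
    h.pos_of_real_eigenvalues hT hD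
  obtain ⟨hy₀, Φ, hΦ, h0, τ, hτ, hx, hneg, rfl⟩ := h
  have hx₀ : (Φ 0).1 = 0 := by simp [h0]
  obtain rfl : (Φ 0).2 = y₀ := by simp [h0]
  have of_integrand : (∀ c ∈ Set.Ioo 0 τ, D * (Φ c).1 - a < 0) →
      ∃ A > 0, (Φ τ).2 ^ 2 - (Φ 0).2 ^ 2 = T * A := fun hz => by
    obtain ⟨c, hc, hmv⟩ := hΦ.exists_sq_sub_sq hτ hx₀ hx
    have := mul_pos_of_neg_of_neg (hneg c hc) (hz c hc)
    exact ⟨_, by positivity, hmv⟩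
  rcases le_or_gt (4 * D) (T ^ 2) with hΔ | hΔ
  · have hs := Real.sq_sqrt (sub_nonneg.2 hΔ)
    have hT : (T - √(T ^ 2 - 4 * D)) / 2 + (T + √(T ^ 2 - 4 * D)) / 2 = T := by ring
    have hD : (T - √(T ^ 2 - 4 * D)) / 2 * ((T + √(T ^ 2 - 4 * D)) / 2) = D := by
      linear_combination -hs / 4
    have ha := hreal hT hD
    exact of_integrand fun c hc => hΦ.snd_deriv_neg hT hD ⟨hc.1.le, hc.2.le⟩
      (by simpa [hx₀] using ha) (by simpa [hx] using ha)
  · have hD : 0 < D := by nlinarith [sq_nonneg T]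
    rcases lt_or_ge 0 a with ha | ha
    · exact of_integrand fun c hc => by linarith [mul_neg_of_pos_of_neg hD (hneg c hc)]
    obtain ⟨c, hc, hmv⟩ := hΦ.exists_sq_sub_sq_centred hτ hx₀ hx
    set u := D * (Φ c).1 - a with hu
    set v := D * (Φ c).2 - T * a with hv
    have hq : 0 < D * u ^ 2 - T * u * v + v ^ 2 := by
      rcases eq_or_ne u 0 with hu0 | hu0
      · have hv0 : v ≠ 0 := fun hv0 => by
          -- Otherwise the orbit would rest at an equilibrium with `x < 0`.
          have hy : T * (Φ c).1 - (Φ c).2 = 0 := by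
            have : D * (T * (Φ c).1 - (Φ c).2) = 0 := by
              linear_combination T * (hu.symm.trans hu0) - hv.symm.trans hv0
            exact (mul_eq_zero.1 this).resolve_left hD.ne'
          have hconst := hΦ.eq_of_equilibrium hy (hu.symm.trans hu0) 0
          exact (hneg c hc).ne (by rw [← hconst, hx₀])
        rw [hu0]
        have := sq_pos_of_ne_zero hv0
        simpa using this
      · nlinarith [sq_nonneg (2 * v - T * u), mul_pos (sub_pos.2 hΔ) (sq_pos_of_ne_zero hu0)]
    have hseg : 0 ≤ a * D * ((Φ τ).2 - (Φ 0).2) :=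
      mul_nonneg_of_nonpos_of_nonpos (mul_nonpos_of_nonpos_of_nonneg ha hD.le) (by linarith)
    refine ⟨((D * u ^ 2 - T * u * v + v ^ 2) * τ + a * D * ((Φ τ).2 - (Φ 0).2)) / D ^ 2,
      by positivity, ?_⟩
    rw [← mul_div_assoc, ← hmv]
    field_simp

theorem sign_add (h : LeftReturn T D a y₀ y₁) (hne : y₀ ≠ 0 ∨ y₁ ≠ 0 ∨ T = 0) :
    SignType.sign (y₀ + y₁) = -SignType.sign T := by
  have hy₁ := h.image_nonpos
  obtain ⟨A, hA, hsq⟩ := h.exists_area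
  have hy₀ := h.1
  rcases (sub_nonneg.2 (hy₁.trans hy₀)).eq_or_lt with heq | hlt
  · have e₀ : y₀ = 0 := by linarith
    have e₁ : y₁ = 0 := by linarith
    have hT : T = 0 := (hne.resolve_left (· e₀)).resolve_left (· e₁)
    simp [e₀, e₁, hT]
  · have hprod : (y₀ + y₁) * (y₀ - y₁) = -T * A := by linear_combination -hsq
    have := congrArg SignType.sign hprod
    rwa [sign_mul, sign_mul, sign_pos hlt, sign_pos hA, mul_one, mul_one, Left.sign_neg] at this

end LeftReturn

theorem IsLeftImage.sign_add {T D a y₀ y₁ : ℝ} (h : IsLeftImage T D a y₀ y₁)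
    (hne : y₀ ≠ 0 ∨ y₁ ≠ 0 ∨ T = 0) : SignType.sign (y₀ + y₁) = -SignType.sign T := by
  rcases h with h | ⟨rfl, rfl, -⟩
  · exact h.sign_add hne
  · simp [(hne.resolve_left (· rfl)).resolve_left (· rfl)]

theorem proposition5 (T D a : ℝ) (hDa : a ^ 2 + D ^ 2 ≠ 0) :
    (∀ y₀ ∈ leftDomain T D a \ {0},
      SignType.sign (y₀ + leftHalfMap T D a y₀) = -SignType.sign T) ∧
    (0 ∈ leftDomain T D a → (leftHalfMap T D a 0 ≠ 0 ∨ T = 0) →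
      SignType.sign (0 + leftHalfMap T D a 0) = -SignType.sign T) ∧
    (∀ y₀ ∈ leftDomain T D a, (y₀ ≠ 0 ∨ leftHalfMap T D a y₀ ≠ 0 ∨ T = 0) →
      (leftHalfMap T D a y₀ = -y₀ ↔ T = 0)) := by
  refine ⟨fun y₀ hy₀ => (leftHalfMap_spec hy₀.1).sign_add (.inl hy₀.2),
    fun h0 hne => (leftHalfMap_spec h0).sign_add (.inr hne), fun y₀ hy₀ hne => ?_⟩
  have h := (leftHalfMap_spec hy₀).sign_add hne
  rw [eq_neg_iff_add_eq_zero, add_comm, ← sign_eq_zero_iff, h, ← Left.sign_neg, sign_eq_zero_iff,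
    neg_eq_zero]
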